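/- All rings are associative, not necessarily commutative, and not assumed to have an identity; subrings are not assumed to contain an identity, and exponents $n$ range over $n\ge 1$. An element $a$ of a ring $R$ is called right (left) strongly $\pi$-regular if $a^n=a^{n+1}x$ (respectively $a^n=xa^{n+1}$) for some $x\in R$ and some $n\ge 1$; it is right strongly regular if this holds with $n=1$, i.e. $a=a^2x$. The ring $R$ is right (left) Dischinger if every right (left) strongly $\pi$-regular element of $R$ is both left and right strongly $\pi$-regular, and Dischinger if it is both right and left Dischinger. For $a\in R$ let $N^r_R(a)$ be the set of nilpotent elements $r\in R$ for which there is a sequence $r_1,r_2,\dots$ in $R$ with $r=r_1a$, $ar_i=r_{i+1}a$ for all $i\ge1$, and $ar_k=0$ for some $k\ge1$; this is a nil subring of $R$. A subring $S$ is nil if all its elements are nilpotent, and nilpotent if $S^k=0$ for some $k\ge1$. The ring $R$ is left Goldie if it satisfies the ascending chain condition on left annihilators of subsets of $R$ and ${}_RR$ has finite uniform dimension, i.e. $R$ contains no infinite direct sum of nonzero left ideals. It is left (right) Noetherian if it satisfies the ascending chain condition on left (right) ideals. Let $R$ be a ring. 1. If every nil subring of $R$ is nilpotent, then $R$ is Dischinger.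 2. If the subring $N^r_R(a)$ is nilpotent for every right strongly regular element $a\in R$, then $R$ is right Dischinger. 3. If $R$ is left Goldie, then $R$ is Dischinger. 4. If $R$ is left Noetherian or right Noetherian, then $R$ is Dischinger. -/

import Mathlib

namespace Dischinger

/-! Rings are associative, not necessarily commutative, and not assumed to have an identity;
"subring" accordingly means `NonUnitalSubring`. -/

/-- The product `f 0 * f 1 * ⋯ * f n` of `n + 1` elements (no identity is needed). -/
def prodSucc {R : Type*} [NonUnitalRing R] (f : ℕ → R) : ℕ → R
  | 0 => f 0
  | n + 1 => prodSucc f n * f (n + 1)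

/-- The positive power `a ^ (n + 1)`. So `powSucc a` enumerates the powers with exponent `≥ 1`. -/
def powSucc {R : Type*} [NonUnitalRing R] (a : R) (n : ℕ) : R :=
  prodSucc (fun _ => a) n

/-- `a ^ n = 0` for some `n ≥ 1`. -/
def IsNil {R : Type*} [NonUnitalRing R] (a : R) : Prop :=
  ∃ n : ℕ, powSucc a n = 0

/-- A nil subring: all of its elements are nilpotent. -/
def IsNilSubring {R : Type*} [NonUnitalRing R] (S : NonUnitalSubring R) : Prop :=
  ∀ s ∈ S, IsNil s

/-- A nilpotent subring: `S ^ k = 0` for some `k ≥ 1`, that is, all products of `k` elements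
of `S` vanish. -/
def IsNilpotentSubring {R : Type*} [NonUnitalRing R] (S : NonUnitalSubring R) : Prop :=
  ∃ n : ℕ, ∀ f : ℕ → R, (∀ i, f i ∈ S) → prodSucc f n = 0

/-! ### Strongly regular and strongly π-regular elements, Dischinger rings -/

/-- `a = a ^ 2 * x` for some `x`. -/
def IsRightStronglyRegular {R : Type*} [NonUnitalRing R] (a : R) : Prop :=
  ∃ x : R, a = a * a * x

/-- `a = x * a ^ 2` for some `x`. -/
def IsLeftStronglyRegular {R : Type*} [NonUnitalRing R] (a : R) : Prop :=
  ∃ x : R, a = x * (a * a)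

/-- `a ^ n = a ^ (n + 1) * x` for some `x` and some `n ≥ 1`. -/
def IsRightStronglyPiRegular {R : Type*} [NonUnitalRing R] (a : R) : Prop :=
  ∃ (x : R) (n : ℕ), powSucc a n = powSucc a (n + 1) * x

/-- `a ^ n = x * a ^ (n + 1)` for some `x` and some `n ≥ 1`. -/
def IsLeftStronglyPiRegular {R : Type*} [NonUnitalRing R] (a : R) : Prop :=
  ∃ (x : R) (n : ℕ), powSucc a n = x * powSucc a (n + 1)

/-- Both left and right strongly π-regular. -/
def IsStronglyPiRegular {R : Type*} [NonUnitalRing R] (a : R) : Prop :=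
  IsLeftStronglyPiRegular a ∧ IsRightStronglyPiRegular a

/-- Both left and right strongly regular. -/
def IsStronglyRegular {R : Type*} [NonUnitalRing R] (a : R) : Prop :=
  IsLeftStronglyRegular a ∧ IsRightStronglyRegular a

/-- Every right strongly π-regular element is strongly π-regular. -/
def IsRightDischinger (R : Type*) [NonUnitalRing R] : Prop :=
  ∀ a : R, IsRightStronglyPiRegular a → IsStronglyPiRegular a

/-- Every left strongly π-regular element is strongly π-regular. -/
def IsLeftDischinger (R : Type*) [NonUnitalRing R] : Prop :=
  ∀ a : R, IsLeftStronglyPiRegular a → IsStronglyPiRegular a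

/-- Both left and right Dischinger. -/
def IsDischinger (R : Type*) [NonUnitalRing R] : Prop :=
  IsLeftDischinger R ∧ IsRightDischinger R

/-! ### Basic facts on positive powers -/

theorem powSucc_zero {R : Type*} [NonUnitalRing R] (a : R) : powSucc a 0 = a := rfl

theorem powSucc_succ {R : Type*} [NonUnitalRing R] (a : R) (n : ℕ) :
    powSucc a (n + 1) = powSucc a n * a := rfl

theorem powSucc_mul {R : Type*} [NonUnitalRing R] (a : R) (m n : ℕ) :
    powSucc a m * powSucc a n = powSucc a (m + n + 1) := by
  induction n with
  | zero => rfl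
  | succ n ih => rw [powSucc_succ, ← mul_assoc, ih]; rfl

theorem powSucc_succ' {R : Type*} [NonUnitalRing R] (a : R) (n : ℕ) :
    powSucc a (n + 1) = a * powSucc a n := by
  have h := powSucc_mul a 0 n
  rw [Nat.zero_add] at h
  exact h.symm

/-! ### The two conditions that may define right (left) Dischinger rings agree -/

theorem powSucc_eq_right {R : Type*} [NonUnitalRing R] {a x : R} {n : ℕ}
    (h : powSucc a n = powSucc a (n + 1) * x) (k : ℕ) :
    ∃ z, powSucc a n = powSucc a (n + k + 1) * z := by
  induction k with
  | zero => exact ⟨x, h⟩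
  | succ k ih =>
    obtain ⟨z, hz⟩ := ih
    refine ⟨x * z, ?_⟩
    have e1 : powSucc a (n + k + 1) = powSucc a k * powSucc a n := by
      rw [powSucc_mul, Nat.add_comm k n]
    have e2 : powSucc a (n + (k + 1) + 1) = powSucc a k * powSucc a (n + 1) := by
      rw [powSucc_mul]; congr 1; omega
    rw [e2, mul_assoc, ← mul_assoc _ x z, ← h, ← mul_assoc, ← e1]
    exact hz

theorem powSucc_eq_left {R : Type*} [NonUnitalRing R] {a x : R} {n : ℕ}
    (h : powSucc a n = x * powSucc a (n + 1)) (k : ℕ) :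
    ∃ z, powSucc a n = z * powSucc a (n + k + 1) := by
  induction k with
  | zero => exact ⟨x, h⟩
  | succ k ih =>
    obtain ⟨z, hz⟩ := ih
    refine ⟨z * x, ?_⟩
    have e1 : powSucc a (n + k + 1) = powSucc a n * powSucc a k := by
      rw [powSucc_mul]
    have e2 : powSucc a (n + (k + 1) + 1) = powSucc a (n + 1) * powSucc a k := by
      rw [powSucc_mul]; congr 1; omega
    rw [e2, mul_assoc, ← mul_assoc x, ← h, ← e1]
    exact hz

theorem isRightDischinger_iff (R : Type*) [NonUnitalRing R] :
    IsRightDischinger R ↔ ∀ a : R, IsRightStronglyRegular a → IsStronglyRegular a := by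
  constructor
  · rintro h a ⟨x, hx⟩
    refine ⟨?_, x, hx⟩
    obtain ⟨⟨y, m, hy⟩, -⟩ := h a ⟨x, 0, hx⟩
    obtain ⟨z, hz⟩ := powSucc_eq_right (n := 0) (a := a) (x := x) hx m
    rw [Nat.zero_add, powSucc_zero] at hz
    refine ⟨y, ?_⟩
    calc a = powSucc a m * (a * z) := by rw [← mul_assoc]; exact hz
      _ = y * (a * (powSucc a (m + 1) * z)) := by
        have hP : powSucc a (m + 1) * z = powSucc a m * (a * z) := by
          rw [powSucc_succ, mul_assoc]
        rw [hP]
        nth_rewrite 1 [hy]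
        rw [powSucc_succ' a m]
        simp only [mul_assoc]
      _ = y * (a * a) := by rw [← hz]
  · rintro h a ⟨x, n, hx⟩
    refine ⟨?_, x, n, hx⟩
    obtain ⟨z, hz⟩ := powSucc_eq_right hx n
    obtain ⟨⟨y, hy⟩, -⟩ := h (powSucc a n) ⟨z, by rw [powSucc_mul]; exact hz⟩
    rw [powSucc_mul] at hy
    cases n with
    | zero => exact ⟨y, 0, hy⟩
    | succ n =>
      refine ⟨y * powSucc a n, n + 1, ?_⟩
      rw [mul_assoc, powSucc_mul]
      convert hy using 3
      omega

theorem isLeftDischinger_iff (R : Type*) [NonUnitalRing R] :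
    IsLeftDischinger R ↔ ∀ a : R, IsLeftStronglyRegular a → IsStronglyRegular a := by
  constructor
  · rintro h a ⟨x, hx⟩
    refine ⟨⟨x, hx⟩, ?_⟩
    obtain ⟨-, y, m, hy⟩ := h a ⟨x, 0, hx⟩
    obtain ⟨z, hz⟩ := powSucc_eq_left (n := 0) (a := a) (x := x) hx m
    rw [Nat.zero_add, powSucc_zero] at hz
    refine ⟨y, ?_⟩
    calc a = z * a * powSucc a m := by rw [mul_assoc, ← powSucc_succ']; exact hz
      _ = z * powSucc a (m + 1) * a * y := by
        rw [hy, powSucc_succ' a m]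
        simp only [mul_assoc]
        rw [← mul_assoc (powSucc a m) a y, ← powSucc_succ, powSucc_succ']
        simp only [mul_assoc]
      _ = a * a * y := by rw [← hz]
  · rintro h a ⟨x, n, hx⟩
    refine ⟨⟨x, n, hx⟩, ?_⟩
    obtain ⟨z, hz⟩ := powSucc_eq_left hx n
    obtain ⟨-, y, hy⟩ := h (powSucc a n) ⟨z, by rw [powSucc_mul]; exact hz⟩
    rw [powSucc_mul] at hy
    cases n with
    | zero => exact ⟨y, 0, hy⟩
    | succ n =>
      refine ⟨powSucc a n * y, n + 1, ?_⟩
      rw [← mul_assoc, powSucc_mul]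
      convert hy using 3
      omega

/-! ### The nil subring `N^r_R(a)` -/

/-- `r = r₁ * a`, `a * rᵢ = rᵢ₊₁ * a` for all `i ≥ 1`, and `a * rₖ = 0` for some `k ≥ 1`, for a
suitable sequence; `ρ i` plays the role of `rᵢ₊₁`. -/
def HasChain {R : Type*} [NonUnitalRing R] (a r : R) : Prop :=
  ∃ ρ : ℕ → R, r = ρ 0 * a ∧ (∀ i, a * ρ i = ρ (i + 1) * a) ∧ ∃ k, a * ρ k = 0

theorem mul_powSucc_eq_zero {R : Type*} [NonUnitalRing R] {a s : R} (h : s * a = 0) (n : ℕ) :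
    s * powSucc a n = 0 := by
  cases n with
  | zero => exact h
  | succ n => rw [powSucc_succ', ← mul_assoc, h, zero_mul]

theorem HasChain.isNil {R : Type*} [NonUnitalRing R] {a r : R} (h : HasChain a r) : IsNil r := by
  obtain ⟨ρ, h0, h1, k, hk⟩ := h
  have hc : ∀ n, powSucc a n * ρ 0 = ρ (n + 1) * powSucc a n := by
    intro n
    induction n with
    | zero => exact h1 0
    | succ n ih => rw [powSucc_succ', mul_assoc, ih, ← mul_assoc, h1, mul_assoc]
  have hp : ∀ n, powSucc r n = prodSucc ρ n * powSucc a n := by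
    intro n
    induction n with
    | zero => exact h0
    | succ n ih =>
      rw [powSucc_succ, ih, h0, mul_assoc, ← mul_assoc _ (ρ 0) a, hc, mul_assoc, ← powSucc_succ,
        ← mul_assoc]
      rfl
  refine ⟨k + 1, ?_⟩
  rw [hp, mul_powSucc_eq_zero]
  change prodSucc ρ k * ρ (k + 1) * a = 0
  rw [mul_assoc, ← h1, hk, mul_zero]

/-- A chain can be cut off after any index where `a * ρ k = 0`. -/
theorem HasChain.exists_eventually {R : Type*} [NonUnitalRing R] {a r : R} (h : HasChain a r) :
    ∃ ρ : ℕ → R, r = ρ 0 * a ∧ (∀ i, a * ρ i = ρ (i + 1) * a) ∧ ∃ k, ∀ i, k ≤ i → a * ρ i = 0 := by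
  obtain ⟨ρ, h0, h1, k, hk⟩ := h
  refine ⟨fun i => if i ≤ k then ρ i else 0, by simpa using h0, ?_, k, ?_⟩
  · intro i
    rcases lt_trichotomy i k with h | h | h
    · have h' : i + 1 ≤ k := h
      simp [h.le, h', h1]
    · subst h
      simp [hk]
    · have h2 : ¬ i ≤ k := by omega
      have h3 : ¬ i + 1 ≤ k := by omega
      simp [h2, h3]
  · intro i hi
    rcases hi.lt_or_eq with h | h
    · have h2 : ¬ i ≤ k := by omega
      simp [h2]
    · subst h
      simp [hk]

/-- The subring `N^r_R(a)` of all nilpotent `r` which satisfy `HasChain a r`. -/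
def rightNilSubring {R : Type*} [NonUnitalRing R] (a : R) : NonUnitalSubring R where
  carrier := {r | IsNil r ∧ HasChain a r}
  add_mem' := by
    rintro r s ⟨-, hr⟩ ⟨-, hs⟩
    obtain ⟨ρ, h0, h1, k, hk⟩ := hr.exists_eventually
    obtain ⟨σ, g0, g1, l, hl⟩ := hs.exists_eventually
    have h : HasChain a (r + s) :=
      ⟨fun i => ρ i + σ i, by simp only [add_mul, ← h0, ← g0],
        fun i => by simp only [add_mul, mul_add, h1, g1],
        k + l, by simp only [mul_add, hk _ (Nat.le_add_right k l), hl _ (Nat.le_add_left l k),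
          add_zero]⟩
    exact ⟨h.isNil, h⟩
  zero_mem' := by
    have h : HasChain a (0 : R) := ⟨fun _ => 0, by simp, by simp, 0, by simp⟩
    exact ⟨h.isNil, h⟩
  neg_mem' := by
    rintro r ⟨-, ρ, h0, h1, k, hk⟩
    have h : HasChain a (-r) :=
      ⟨fun i => -ρ i, by simp only [neg_mul, ← h0], fun i => by simp only [neg_mul, mul_neg, h1],
        k, by simp only [mul_neg, hk, neg_zero]⟩
    exact ⟨h.isNil, h⟩
  mul_mem' := by
    rintro r s ⟨-, ρ, h0, h1, k, hk⟩ ⟨-, σ, g0, g1, -⟩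
    have h : HasChain a (r * s) := by
      refine ⟨fun i => ρ i * (a * σ i), by simp only [h0, g0, mul_assoc], fun i => ?_, k, ?_⟩
      · calc a * (ρ i * (a * σ i)) = a * ρ i * (a * σ i) := by rw [mul_assoc]
          _ = ρ (i + 1) * (a * σ (i + 1)) * a := by rw [h1, g1]; simp only [mul_assoc]
      · rw [← mul_assoc, hk, zero_mul]
    exact ⟨h.isNil, h⟩

/-! ### Chain conditions -/

/-- An additive subgroup `I` with `R I ⊆ I`. -/
def IsLeftIdeal {R : Type*} [NonUnitalRing R] (I : AddSubgroup R) : Prop :=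
  ∀ r : R, ∀ x ∈ I, r * x ∈ I

/-- An additive subgroup `I` with `I R ⊆ I`. -/
def IsRightIdeal {R : Type*} [NonUnitalRing R] (I : AddSubgroup R) : Prop :=
  ∀ r : R, ∀ x ∈ I, x * r ∈ I

/-- The left annihilator `{r | r X = 0}` of a subset `X`. -/
def leftAnnihilator {R : Type*} [NonUnitalRing R] (X : Set R) : AddSubgroup R where
  carrier := {r | ∀ x ∈ X, r * x = 0}
  add_mem' := fun hr hs x hx => by rw [add_mul, hr x hx, hs x hx, add_zero]
  zero_mem' := fun x _ => zero_mul x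
  neg_mem' := fun hr x hx => by rw [neg_mul, hr x hx, neg_zero]

/-- The ascending chain condition for the additive subgroups that satisfy `P`. -/
def ACCOn {R : Type*} [NonUnitalRing R] (P : AddSubgroup R → Prop) : Prop :=
  ∀ I : ℕ → AddSubgroup R, (∀ n, P (I n)) → Monotone I → ∃ n, ∀ m, n ≤ m → I m = I n

/-- `R` has finite uniform dimension as a left module over itself: there is no infinite
independent family (direct sum) of nonzero left ideals. -/
def HasFiniteLeftUniformDim (R : Type*) [NonUnitalRing R] : Prop :=
  ¬ ∃ I : ℕ → AddSubgroup R, (∀ n, IsLeftIdeal (I n)) ∧ (∀ n, I n ≠ ⊥) ∧ iSupIndep I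

/-- Ascending chain condition on left annihilators of subsets, and finite left uniform
dimension. -/
def IsLeftGoldie (R : Type*) [NonUnitalRing R] : Prop :=
  ACCOn (fun I : AddSubgroup R => ∃ X : Set R, I = leftAnnihilator X) ∧
    HasFiniteLeftUniformDim R

/-- Ascending chain condition on left ideals. -/
def IsLeftNoetherian (R : Type*) [NonUnitalRing R] : Prop :=
  ACCOn (IsLeftIdeal (R := R))

/-- Ascending chain condition on right ideals. -/
def IsRightNoetherian (R : Type*) [NonUnitalRing R] : Prop :=
  ACCOn (IsRightIdeal (R := R))

end Dischinger

/-! In ordinary exponents, `a = a^2 x` puts each `c_n = a^2 - x^(n+1) a^(n+3)` into `N^r(a)`, while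
`c_n^(k+1)` is `a^(2k+2)` up to a left multiple of `a^(n+3)`. A bound on the nilpotency index of the
`c_n`, uniform in `n`, therefore makes `a` left strongly π-regular
(`isLeftStronglyPiRegular_of_chainElement`). Nilpotency of `N^r(a)` supplies the bound; the
left-hand versions come from the opposite ring.

If `R` is left Goldie, ACC on left annihilators alone gives the left Dischinger property. For the
right one it bounds the nilpotency index on the left singular elements (`leftSingular_bounded`), and
finite uniform dimension makes `c_n^2` left singular. Left Noetherian rings are left Goldie, and the
Dischinger property is self-opposite. -/

namespace Dischinger

/-! ### Positive powers and reduction to strongly regular elements -/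

section Basic

variable {R : Type*} [NonUnitalRing R]

theorem prodSucc_succ' (f : ℕ → R) (n : ℕ) :
    prodSucc f (n + 1) = f 0 * prodSucc (fun i => f (i + 1)) n := by
  induction n with
  | zero => rfl
  | succ n ih =>
    change prodSucc f (n + 1) * f (n + 2) = _
    rw [ih, mul_assoc]
    rfl

theorem powSucc_powSucc (a : R) (n m : ℕ) :
    powSucc (powSucc a n) m = powSucc a (n * m + n + m) := by
  induction m with
  | zero => rw [powSucc_zero, Nat.mul_zero, Nat.zero_add, Nat.add_zero]
  | succ m ih => rw [powSucc_succ, ih, powSucc_mul]; congr 1; ring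

/-- A left strongly `π`-regular power forces left strong `π`-regularity. -/
theorem IsLeftStronglyPiRegular.of_powSucc {a : R} {n : ℕ}
    (h : IsLeftStronglyPiRegular (powSucc a n)) : IsLeftStronglyPiRegular a := by
  obtain ⟨x, m, h⟩ := h
  rw [powSucc_powSucc, powSucc_powSucc] at h
  cases n with
  | zero => exact ⟨x, _, by convert h using 3; ring⟩
  | succ n =>
    refine ⟨x * powSucc a n, _, h.trans ?_⟩
    rw [mul_assoc, powSucc_mul]
    congr 2
    ring

/-- It suffices to test the right Dischinger property on right strongly regular elements. -/
theorem isRightDischinger_of_forall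
    (h : ∀ a : R, IsRightStronglyRegular a → IsLeftStronglyPiRegular a) :
    IsRightDischinger R := by
  rintro a ⟨x, n, hx⟩
  obtain ⟨z, hz⟩ := powSucc_eq_right hx n
  exact ⟨(h (powSucc a n) ⟨z, by rw [powSucc_mul]; exact hz⟩).of_powSucc, x, n, hx⟩

end Basic

/-! ### Passage to the opposite ring -/

section Opposite

open MulOpposite

variable {R : Type*} [NonUnitalRing R]

theorem powSucc_op (a : R) (n : ℕ) : powSucc (op a) n = op (powSucc a n) := by
  induction n with
  | zero => rfl
  | succ n ih => rw [powSucc_succ, ih, powSucc_succ', op_mul]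

theorem isLeftStronglyPiRegular_op {a : R} :
    IsLeftStronglyPiRegular (op a) ↔ IsRightStronglyPiRegular a := by
  constructor
  · rintro ⟨x, n, h⟩
    refine ⟨unop x, n, op_injective ?_⟩
    rw [powSucc_op, powSucc_op] at h
    rw [h, op_mul, op_unop]
  · rintro ⟨x, n, h⟩
    exact ⟨op x, n, by rw [powSucc_op, powSucc_op, ← op_mul, ← h]⟩

theorem isRightStronglyPiRegular_op {a : R} :
    IsRightStronglyPiRegular (op a) ↔ IsLeftStronglyPiRegular a := by
  constructor
  · rintro ⟨x, n, h⟩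
    refine ⟨unop x, n, op_injective ?_⟩
    rw [powSucc_op, powSucc_op] at h
    rw [h, op_mul, op_unop]
  · rintro ⟨x, n, h⟩
    exact ⟨op x, n, by rw [powSucc_op, powSucc_op, ← op_mul, ← h]⟩

theorem isStronglyPiRegular_op {a : R} : IsStronglyPiRegular (op a) ↔ IsStronglyPiRegular a := by
  rw [IsStronglyPiRegular, isLeftStronglyPiRegular_op, isRightStronglyPiRegular_op, and_comm,
    IsStronglyPiRegular]

theorem isRightDischinger_op : IsRightDischinger Rᵐᵒᵖ ↔ IsLeftDischinger R := by
  constructor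
  · intro h a ha
    exact isStronglyPiRegular_op.1 (h (op a) (isRightStronglyPiRegular_op.2 ha))
  · intro h a ha
    exact isStronglyPiRegular_op.2 (h (unop a) (isRightStronglyPiRegular_op.1 ha))

theorem isLeftDischinger_op : IsLeftDischinger Rᵐᵒᵖ ↔ IsRightDischinger R := by
  constructor
  · intro h a ha
    exact isStronglyPiRegular_op.1 (h (op a) (isLeftStronglyPiRegular_op.2 ha))
  · intro h a ha
    exact isStronglyPiRegular_op.2 (h (unop a) (isLeftStronglyPiRegular_op.1 ha))

theorem isDischinger_op : IsDischinger Rᵐᵒᵖ ↔ IsDischinger R := by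
  rw [IsDischinger, isLeftDischinger_op, isRightDischinger_op, and_comm, IsDischinger]

/-- The opposite of a subring. -/
def opSubring (S : NonUnitalSubring Rᵐᵒᵖ) : NonUnitalSubring R where
  carrier := {r | op r ∈ S}
  add_mem' := fun {a b} ha hb => S.add_mem (x := op a) (y := op b) ha hb
  zero_mem' := S.zero_mem
  neg_mem' := fun {a} ha => S.neg_mem (x := op a) ha
  mul_mem' := fun {a b} ha hb => S.mul_mem (x := op b) (y := op a) hb ha

theorem IsRightNoetherian.op (h : IsRightNoetherian R) : IsLeftNoetherian Rᵐᵒᵖ := by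
  intro I hI hmono
  let e : R →+ Rᵐᵒᵖ := (opAddEquiv : R ≃+ Rᵐᵒᵖ).toAddMonoidHom
  obtain ⟨n, hn⟩ := h (fun n => (I n).comap e) (fun n r x hx => hI n (MulOpposite.op r) _ hx)
    (fun i j hij x hx => hmono hij hx)
  refine ⟨n, fun m hm => ?_⟩
  ext x
  exact SetLike.ext_iff.1 (hn m hm) (unop x)

end Opposite

/-! ### Elements of `N^r(a)` and bounded nilpotency index -/

section ChainElement

variable {R : Type*} [NonUnitalRing R] {a x : R}

theorem powSucc_mul_powSucc (h : a = a * a * x) (n : ℕ) :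
    powSucc a (n + 1) * powSucc x n = a := by
  induction n with
  | zero => exact h.symm
  | succ n ih =>
    rw [powSucc_succ', powSucc_succ x, mul_assoc, ← mul_assoc _ _ x, ih, ← mul_assoc, ← h]

/-- For `a = a ^ 2 * x` this is the typical element of the nil subring of `a`. -/
def chainElement (a x : R) (n : ℕ) : R :=
  a * a - powSucc x n * powSucc a (n + 2)

theorem chainElement_eq_mul (a x : R) (n : ℕ) :
    chainElement a x n = (a - powSucc x n * powSucc a (n + 1)) * a := by
  rw [chainElement, sub_mul, mul_assoc, ← powSucc_succ]

theorem hasChain_chainElement (h : a = a * a * x) (n : ℕ) : HasChain a (chainElement a x n) := by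
  -- Left multiplication by `a` cancels one `x` through `a^2 x = a`, and one `a` moves out to the
  -- right. The last nonzero entry is `a - a x a`, which `a` kills, so zeros may follow.
  refine ⟨fun i => match i with
    | 0 => a - powSucc x n * powSucc a (n + 1)
    | i + 1 => if i ≤ n then a - a * powSucc x (n - i) * powSucc a (n - i) else 0,
    chainElement_eq_mul a x n, ?_, n + 2, ?_⟩
  · rintro (_ | i)
    · simp only [Nat.zero_le, if_true, Nat.sub_zero, mul_sub, sub_mul, mul_assoc, powSucc_succ]
    · rcases lt_trichotomy i n with hi | rfl | hi
      · obtain ⟨k, rfl⟩ : ∃ k, n = i + k + 1 := ⟨n - i - 1, by omega⟩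
        have e1 : i + k + 1 - i = k + 1 := by omega
        have e2 : i + k + 1 - (i + 1) = k := by omega
        have e3 : i + 1 ≤ i + k + 1 := by omega
        have e4 : a * (a * powSucc x (k + 1) * powSucc a (k + 1)) =
            a * powSucc x k * powSucc a k * a := by
          rw [powSucc_succ', ← mul_assoc, ← mul_assoc, ← mul_assoc, ← h, powSucc_succ, ← mul_assoc]
        simp only [hi.le, e3, if_true, e1, e2, mul_sub, sub_mul, e4]
      · have e : a * (a * x * a) = a * a := by
          rw [← mul_assoc, ← mul_assoc, ← h]
        simp [powSucc_zero, mul_sub, e]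
      · have h1 : ¬ i ≤ n := by omega
        have h2 : ¬ i + 1 ≤ n := by omega
        simp [h1, h2]
  · have h1 : ¬ n + 1 ≤ n := by omega
    simp [h1]

theorem powSucc_chainElement (a x : R) (n k : ℕ) :
    ∃ u, powSucc (chainElement a x n) k = powSucc a (2 * k + 1) - u * powSucc a (n + 2) := by
  induction k with
  | zero => exact ⟨powSucc x n, rfl⟩
  | succ k ih =>
    obtain ⟨u, hu⟩ := ih
    refine ⟨powSucc x n * powSucc a (2 * k + 1) + chainElement a x n * u, ?_⟩
    have e1 : a * a * powSucc a (2 * k + 1) = powSucc a (2 * (k + 1) + 1) := by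
      rw [mul_assoc, ← powSucc_succ', ← powSucc_succ']
      rfl
    have e2 : powSucc a (n + 2) * powSucc a (2 * k + 1) =
        powSucc a (2 * k + 1) * powSucc a (n + 2) := by
      rw [powSucc_mul, powSucc_mul]; congr 1; omega
    rw [powSucc_succ', hu, mul_sub]
    nth_rewrite 1 [chainElement]
    rw [sub_mul, e1, mul_assoc (powSucc x n), e2, add_mul]
    simp only [mul_assoc]
    abel

/-- A common bound for the nilpotency indices of the chain elements makes `a` left strongly
`π`-regular. -/
theorem isLeftStronglyPiRegular_of_chainElement {k : ℕ}
    (h : ∀ n, powSucc (chainElement a x n) k = 0) : IsLeftStronglyPiRegular a := by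
  -- Index `2 * k` makes the two exponents consecutive: `a^(2k+2) = u a^(2k+3)`.
  obtain ⟨u, hu⟩ := powSucc_chainElement a x (2 * k) k
  rw [h] at hu
  exact ⟨u, 2 * k + 1, (sub_eq_zero.1 hu.symm)⟩

theorem IsNilpotentSubring.exists_powSucc_eq_zero {S : NonUnitalSubring R}
    (h : IsNilpotentSubring S) : ∃ k, ∀ s ∈ S, powSucc s k = 0 := by
  obtain ⟨k, hk⟩ := h
  exact ⟨k, fun s hs => hk _ fun _ => hs⟩

/-- The ring is right Dischinger if the nil subrings of its right strongly regular elements are of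
bounded index. -/
theorem isRightDischinger_of_bounded_index
    (h : ∀ a : R, IsRightStronglyRegular a → ∃ k, ∀ s ∈ rightNilSubring a, powSucc s k = 0) :
    IsRightDischinger R := by
  refine isRightDischinger_of_forall fun a ha => ?_
  obtain ⟨k, hk⟩ := h a ha
  obtain ⟨x, hx⟩ := ha
  refine isLeftStronglyPiRegular_of_chainElement (x := x) (k := k) fun n => hk _ ?_
  have := hasChain_chainElement hx n
  exact ⟨this.isNil, this⟩

theorem isDischinger_of_nil_subrings_nilpotent
    (h : ∀ S : NonUnitalSubring R, IsNilSubring S → IsNilpotentSubring S) : IsDischinger R := by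
  constructor
  · refine isRightDischinger_op.1 (isRightDischinger_of_bounded_index fun a _ => ?_)
    obtain ⟨k, hk⟩ := (h (opSubring (rightNilSubring a)) (fun s hs => by
      obtain ⟨n, hn⟩ := hs.1
      rw [powSucc_op] at hn
      exact ⟨n, MulOpposite.op_injective hn⟩)).exists_powSucc_eq_zero
    refine ⟨k, fun s hs => ?_⟩
    have := hk (MulOpposite.unop s) hs
    rw [← MulOpposite.op_unop s, powSucc_op, this, MulOpposite.op_zero]
  · exact isRightDischinger_of_bounded_index fun a _ =>
      (h (rightNilSubring a) fun s (hs : IsNil s ∧ HasChain a s) => hs.1).exists_powSucc_eq_zero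

end ChainElement

/-! ### Left Goldie and Noetherian rings -/

section Goldie

variable {R : Type*} [NonUnitalRing R]

/-- The ascending chain condition on left annihilators of subsets. -/
abbrev ACCLeftAnnihilators (R : Type*) [NonUnitalRing R] : Prop :=
  ACCOn (fun I : AddSubgroup R => ∃ X : Set R, I = leftAnnihilator X)

/-- Once the left annihilators of the powers of `a` stabilise, some power `b = y b^2` has the same
left annihilator as `b^2`. This allows cancelling one `b` on the right, which turns the left
equation into a right one. -/
theorem ACCLeftAnnihilators.isLeftDischinger (h : ACCLeftAnnihilators R) : IsLeftDischinger R := by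
  refine isRightDischinger_op.1 (isRightDischinger_of_forall fun a' ha => ?_)
  obtain ⟨a, rfl⟩ := MulOpposite.op_surjective a'
  obtain ⟨x', hx⟩ := ha
  obtain ⟨x, rfl⟩ := MulOpposite.op_surjective x'
  replace hx : powSucc a 0 = x * powSucc a (0 + 1) := MulOpposite.op_injective hx
  obtain ⟨n, hn⟩ := h (fun n => leftAnnihilator {powSucc a n}) (fun n => ⟨_, rfl⟩)
    (monotone_nat_of_le_succ fun n r hr => by
      rintro _ rfl
      rw [powSucc_succ, ← mul_assoc, hr _ rfl, zero_mul])
  have key : ∀ r, r * powSucc a (n + n + 1) = 0 → r * powSucc a n = 0 := by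
    intro r hr
    have : r ∈ leftAnnihilator {powSucc a (n + n + 1)} := by
      rintro _ rfl; exact hr
    rw [hn _ (by omega)] at this
    exact this _ rfl
  obtain ⟨y, hy⟩ := powSucc_eq_left hx n
  have hz : powSucc a n = y * powSucc a (n + n + 1) := by
    cases n with
    | zero => exact hy
    | succ n =>
      have := congrArg (· * powSucc a n) hy
      simp only [powSucc_zero] at this
      rw [← powSucc_succ', mul_assoc, powSucc_mul] at this
      convert this using 3
      omega
  rw [← powSucc_mul] at hz key
  refine IsLeftStronglyPiRegular.of_powSucc (n := n) ?_
  rw [powSucc_op, isLeftStronglyPiRegular_op]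
  generalize powSucc a n = b at hz key ⊢
  -- `y b - b y` kills `b^2` from the left, hence kills `b`.
  have h1 : b = b * y * b := by
    have := key (y * b - b * y) (by
      rw [sub_mul, mul_assoc b y, ← hz, mul_assoc y b, ← mul_assoc b b b, ← mul_assoc y, ← hz,
        sub_self])
    rw [sub_mul, sub_eq_zero, mul_assoc, ← hz] at this
    exact this
  have h2 : b = b * b * (y * y * b) := by
    have := key (b * y - b * b * (y * y)) (by
      have e : b * b * (y * y) * (b * b) = b * (b * y * (y * (b * b))) := by simp only [mul_assoc]
      rw [sub_mul, e, ← hz, ← h1, mul_assoc b y, ← hz, sub_self])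
    rw [sub_mul, sub_eq_zero, ← h1, mul_assoc] at this
    exact this
  exact ⟨_, 0, h2⟩

/-- The elements whose left annihilator meets every left ideal of the form `R * z ≠ 0`. -/
def leftSingular (R : Type*) [NonUnitalRing R] : Set R :=
  {w | ∀ z : R, (∃ c, c * z ≠ 0) → ∃ c, c * z ≠ 0 ∧ c * z * w = 0}

theorem mul_mem_leftSingular_left (q : R) {w : R} (hw : w ∈ leftSingular R) :
    q * w ∈ leftSingular R := by
  rintro s ⟨c, hc⟩
  by_cases h : ∃ c, c * (s * q) ≠ 0
  · obtain ⟨c, h1, h2⟩ := hw _ h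
    refine ⟨c, fun h0 => h1 (by rw [← mul_assoc, h0, zero_mul]), ?_⟩
    simpa only [mul_assoc] using h2
  · push Not at h
    refine ⟨c, hc, ?_⟩
    rw [mul_assoc, ← mul_assoc s, ← mul_assoc, h, zero_mul]

theorem leftAnnihilator_singleton_lt {z w : R} (hz : ∃ c, c * z ≠ 0) (hw : w ∈ leftSingular R) :
    leftAnnihilator {z} < leftAnnihilator {z * w} := by
  obtain ⟨c, h1, h2⟩ := hw z hz
  refine lt_of_le_of_ne (fun r hr => ?_) fun he => h1 ?_
  · rintro _ rfl
    rw [← mul_assoc, hr _ rfl, zero_mul]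
  · have : c ∈ leftAnnihilator {z * w} := by
      rintro _ rfl
      rw [← mul_assoc, h2]
    rw [← he] at this
    exact this _ rfl

/-- Take `n` where the left annihilators of the product sets `P n` stabilise. If `R z (P n) ≠ 0`, a
further singular factor can be inserted without killing the product. So `z` can be replaced by some
`z * w` with strictly larger left annihilator, endlessly, against ACC. -/
theorem ACCLeftAnnihilators.leftSingular_bounded (h : ACCLeftAnnihilators R) :
    ∃ k, ∀ w ∈ leftSingular R, powSucc w k = 0 := by
  let P : ℕ → Set R := fun n => {p | ∃ f : ℕ → R, (∀ i, f i ∈ leftSingular R) ∧ p = prodSucc f n}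
  obtain ⟨n, hn⟩ := h (fun n => leftAnnihilator (P n)) (fun n => ⟨_, rfl⟩)
    (monotone_nat_of_le_succ fun n r hr => by
      rintro _ ⟨f, hf, rfl⟩
      change r * (prodSucc f n * f (n + 1)) = 0
      rw [← mul_assoc, hr _ ⟨f, hf, rfl⟩, zero_mul])
  let Bad : R → Prop := fun z => ∃ c, ∃ p ∈ P n, c * z * p ≠ 0
  have step : ∀ z : {z // Bad z}, ∃ z' : {z // Bad z},
      leftAnnihilator {z.1} < leftAnnihilator {z'.1} := by
    rintro ⟨z, c, p, hp, hne⟩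
    have h1 : c * z ∉ leftAnnihilator (P (n + 1)) := by
      rw [hn _ (Nat.le_succ n)]
      exact fun h0 => hne (h0 p hp)
    have h2 : ∃ f : ℕ → R, (∀ i, f i ∈ leftSingular R) ∧ c * z * prodSucc f (n + 1) ≠ 0 := by
      by_contra hcon
      push Not at hcon
      refine h1 ?_
      rintro _ ⟨f, hf, rfl⟩
      exact hcon f hf
    obtain ⟨f, hf, hcf⟩ := h2
    rw [prodSucc_succ', ← mul_assoc, mul_assoc c] at hcf
    exact ⟨⟨z * f 0, c, _, ⟨fun i => f (i + 1), fun i => hf _, rfl⟩, hcf⟩,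
      leftAnnihilator_singleton_lt ⟨c, fun h0 => hne (by rw [h0, zero_mul])⟩ (hf 0)⟩
  choose g hg using step
  have noBad : ∀ z, ¬ Bad z := by
    intro z hz
    have hlt : ∀ i, leftAnnihilator {(g^[i] ⟨z, hz⟩).1} <
        leftAnnihilator {(g^[i + 1] ⟨z, hz⟩).1} := fun i => by
      rw [Function.iterate_succ_apply']
      exact hg _
    obtain ⟨m, hm⟩ := h (fun i => leftAnnihilator {(g^[i] ⟨z, hz⟩).1}) (fun i => ⟨_, rfl⟩)
      (monotone_nat_of_le_succ fun i => (hlt i).le)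
    exact (hlt m).ne' (hm (m + 1) (Nat.le_succ m))
  -- The two extra factors `w` serve as `c` and `z` in `Bad`, needed for want of an identity.
  refine ⟨n + 2, fun w hw => ?_⟩
  by_contra hne
  refine noBad w ⟨w, powSucc w n, ⟨fun _ => w, fun _ => hw, rfl⟩, ?_⟩
  rwa [powSucc_succ', powSucc_succ', ← mul_assoc] at hne

/-- A family of subgroups is independent if each member is disjoint from a subgroup that contains
all the later ones. -/
theorem iSupIndep_of_antitone {A : Type*} [AddCommGroup A] {J L : ℕ → AddSubgroup A}
    (hL : Antitone L) (hJL : ∀ n, J n ≤ L n) (hd : ∀ n, J n ⊓ L (n + 1) = ⊥) : iSupIndep J := by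
  classical
  refine iSupIndep_of_dfinsuppSumAddHom_injective' J ?_
  rw [injective_iff_map_eq_zero]
  intro m hm
  ext i
  -- With the earlier components zero, the `i`-th is minus a sum of later ones, hence lies in `L (i
  -- + 1)`.
  induction i using Nat.strong_induction_on with
  | _ i ih =>
    rw [DFinsupp.sumAddHom_apply, DFinsupp.sum] at hm
    by_cases hi : i ∈ m.support
    · rw [← Finset.add_sum_erase _ _ hi] at hm
      have h1 : (m i : A) ∈ L (i + 1) := by
        change (J i).subtype (m i) ∈ _
        rw [eq_neg_of_add_eq_zero_left hm]
        refine neg_mem (sum_mem fun j hj => ?_)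
        have hji := Finset.ne_of_mem_erase hj
        rcases lt_or_gt_of_ne hji with hlt | hgt
        · have := ih j hlt
          simp only [DFinsupp.coe_zero, Pi.zero_apply, ZeroMemClass.coe_zero] at this
          change (m j : A) ∈ _
          rw [this]
          exact zero_mem _
        · exact hL hgt (hJL j (m j).2)
      have h2 : (m i : A) ∈ J i ⊓ L (i + 1) := ⟨(m i).2, h1⟩
      rw [hd] at h2
      exact h2
    · rw [DFinsupp.notMem_support_iff.1 hi]
      rfl

/-- The left ideal `R * w`. -/
def leftMultiples (w : R) : AddSubgroup R := (AddMonoidHom.mulRight w).range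

theorem mem_leftMultiples {w y : R} : y ∈ leftMultiples w ↔ ∃ c, c * w = y := Iff.rfl

theorem isLeftIdeal_leftMultiples (w : R) : IsLeftIdeal (leftMultiples w) := by
  rintro r _ ⟨c, rfl⟩
  exact ⟨r * c, mul_assoc _ _ _⟩

theorem antitone_leftMultiples_powSucc (a : R) : Antitone fun n => leftMultiples (powSucc a n) :=
  antitone_nat_of_succ_le fun n => by
    rintro _ ⟨c, rfl⟩
    exact ⟨c * a, by
      change c * a * powSucc a n = c * powSucc a (n + 1)
      rw [powSucc_succ', mul_assoc]⟩

/-- Far enough along, each `R a^m` is essential in `R a^n`. Otherwise, iterating the failure `n ↦ m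
n` produces an infinite independent family of nonzero left ideals. -/
theorem HasFiniteLeftUniformDim.exists_essential (h : HasFiniteLeftUniformDim R) (a : R) :
    ∃ n, ∀ m, n ≤ m → ∀ I : AddSubgroup R, IsLeftIdeal I → I ≤ leftMultiples (powSucc a n) →
      I ⊓ leftMultiples (powSucc a m) = ⊥ → I = ⊥ := by
  by_contra hcon
  push Not at hcon
  choose m hm I hI hle hdis hne using hcon
  refine h ⟨fun k => I (m^[k] 0), fun k => hI _, fun k => hne _,
    iSupIndep_of_antitone (L := fun k => leftMultiples (powSucc a (m^[k] 0))) ?_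
      (fun k => hle _) fun k => ?_⟩
  · refine (antitone_leftMultiples_powSucc a).comp_monotone (monotone_nat_of_le_succ fun k => ?_)
    rw [Function.iterate_succ_apply']
    exact hm _
  · rw [Function.iterate_succ_apply']
    exact hdis _

/-- In a ring of finite left uniform dimension, `a ^ n` maps the right annihilators of all powers
of `a` into the left singular ideal, for some `n`. -/
theorem HasFiniteLeftUniformDim.exists_mul_mem_leftSingular (h : HasFiniteLeftUniformDim R)
    (a : R) :
    ∃ n, ∀ m, n ≤ m → ∀ z, powSucc a m * z = 0 → powSucc a n * z ∈ leftSingular R := by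
  obtain ⟨n, hn⟩ := h.exists_essential a
  refine ⟨n, fun m hm z hz s hs => ?_⟩
  obtain ⟨c₀, hc₀⟩ := hs
  by_cases h0 : leftMultiples (s * powSucc a n) = ⊥
  · refine ⟨c₀, hc₀, ?_⟩
    have : c₀ * (s * powSucc a n) ∈ leftMultiples (s * powSucc a n) := ⟨c₀, rfl⟩
    rw [h0, AddSubgroup.mem_bot] at this
    rw [← mul_assoc, mul_assoc c₀, this, zero_mul]
  -- By essentiality some nonzero `c s a^(n+1)` equals `d a^(m+1)`, which `z` annihilates.
  · have h1 : ¬ leftMultiples (s * powSucc a n) ⊓ leftMultiples (powSucc a m) = ⊥ := fun h1 =>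
      h0 (hn m hm _ (isLeftIdeal_leftMultiples _) (by
        rintro _ ⟨c, rfl⟩
        exact ⟨c * s, mul_assoc _ _ _⟩) h1)
    obtain ⟨y, ⟨hy1, hy2⟩, hy0⟩ := (AddSubgroup.ne_bot_iff_exists_ne_zero.1 h1).elim
      fun y hy => (⟨y.1, y.2, fun h => hy (Subtype.ext h)⟩ :
        ∃ y, y ∈ leftMultiples (s * powSucc a n) ⊓ leftMultiples (powSucc a m) ∧ y ≠ 0)
    obtain ⟨c, rfl⟩ := mem_leftMultiples.1 hy1
    obtain ⟨d, hd⟩ := mem_leftMultiples.1 hy2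
    refine ⟨c, fun h => hy0 (by rw [← mul_assoc, h, zero_mul]), ?_⟩
    rw [← mul_assoc, mul_assoc c, ← hd, mul_assoc, hz, mul_zero]

/-- Since `a` is right divisible by all its powers, `a c_N` can be written with any power of `a` in
front; moreover `a^(N+2) c_N = 0` because `a^(N+2) x^(N+1) = a`. -/
theorem exists_mul_chainElement {a x : R} (h : a = a * a * x) (n N : ℕ) :
    ∃ z, a * chainElement a x N = powSucc a n * z ∧ powSucc a (n + N + 1) * z = 0 := by
  obtain ⟨y, hy⟩ := powSucc_eq_right (a := a) (n := 0) (x := x) h n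
  rw [powSucc_zero, Nat.zero_add, powSucc_succ, mul_assoc] at hy
  have e : a * chainElement a x N = powSucc a n * (a * y * chainElement a x N) := by
    rw [← mul_assoc, ← hy]
  refine ⟨_, e, ?_⟩
  have e' : powSucc a (n + N + 1) = powSucc a N * powSucc a n := by
    rw [powSucc_mul, Nat.add_comm N]
  rw [e', mul_assoc, ← e, ← mul_assoc, ← powSucc_succ, chainElement, mul_sub, ← mul_assoc,
    ← mul_assoc, powSucc_mul_powSucc h, ← powSucc_succ, ← powSucc_succ, ← powSucc_succ', sub_self]

theorem IsLeftGoldie.isRightDischinger (h : IsLeftGoldie R) : IsRightDischinger R := by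
  refine isRightDischinger_of_forall fun a ⟨x, hx⟩ => ?_
  obtain ⟨n, hn⟩ := h.2.exists_mul_mem_leftSingular a
  obtain ⟨k, hk⟩ := ACCLeftAnnihilators.leftSingular_bounded h.1
  -- The index is that of the `(k+1)`-st power of a square: `c_N^2` is a left multiple of `a c_N`,
  -- hence left singular.
  refine isLeftStronglyPiRegular_of_chainElement (x := x) (k := 1 * k + 1 + k) fun N => ?_
  rw [← powSucc_powSucc]
  refine hk _ ?_
  obtain ⟨z, hz, hz0⟩ := exists_mul_chainElement hx n N
  rw [powSucc_succ, powSucc_zero]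
  nth_rewrite 1 [chainElement_eq_mul]
  rw [mul_assoc, hz]
  exact mul_mem_leftSingular_left _ (hn _ (by omega) z hz0)

theorem IsLeftGoldie.isDischinger (h : IsLeftGoldie R) : IsDischinger R :=
  ⟨ACCLeftAnnihilators.isLeftDischinger h.1, h.isRightDischinger⟩

theorem isLeftIdeal_leftAnnihilator (X : Set R) : IsLeftIdeal (leftAnnihilator X) :=
  fun r y hy x hx => by rw [mul_assoc, hy x hx, mul_zero]

theorem isLeftIdeal_iSup {ι : Sort*} {I : ι → AddSubgroup R} (h : ∀ i, IsLeftIdeal (I i)) :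
    IsLeftIdeal (⨆ i, I i) := by
  intro r
  have : ⨆ i, I i ≤ (⨆ i, I i).comap (AddMonoidHom.mulLeft r) :=
    iSup_le fun i x hx => AddSubgroup.mem_iSup_of_mem i (h i r x hx)
  exact this

theorem IsLeftNoetherian.isLeftGoldie (h : IsLeftNoetherian R) : IsLeftGoldie R := by
  constructor
  · intro I hI
    refine h I fun n => ?_
    obtain ⟨X, hX⟩ := hI n
    rw [hX]
    exact isLeftIdeal_leftAnnihilator X
  · rintro ⟨I, hI, hne, hind⟩
    -- The partial sums of an infinite direct sum would ascend strictly.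
    obtain ⟨n, hn⟩ := h (fun n => ⨆ i, ⨆ _ : i < n, I i)
      (fun n => isLeftIdeal_iSup fun i => isLeftIdeal_iSup fun _ => hI i)
      (fun n m hnm => iSup_mono fun i => iSup_mono' fun hi => ⟨hi.trans_le hnm, le_rfl⟩)
    have h1 : I n ≤ ⨆ i, ⨆ _ : i < n, I i := by
      rw [← hn (n + 1) (Nat.le_succ n)]
      exact le_iSup₂_of_le n (Nat.lt_succ_self n) le_rfl
    have h2 : ⨆ i, ⨆ _ : i < n, I i ≤ ⨆ i, ⨆ _ : i ≠ n, I i :=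
      iSup_mono fun i => iSup_mono' fun hi => ⟨hi.ne, le_rfl⟩
    exact hne n (le_bot_iff.1 (hind n le_rfl (h1.trans h2)))

end Goldie

end Dischinger

theorem corollary2p13 {R : Type*} [NonUnitalRing R] :
    ((∀ S : NonUnitalSubring R, Dischinger.IsNilSubring S → Dischinger.IsNilpotentSubring S) →
      Dischinger.IsDischinger R) ∧
    ((∀ a : R, Dischinger.IsRightStronglyRegular a →
        Dischinger.IsNilpotentSubring (Dischinger.rightNilSubring a)) →
      Dischinger.IsRightDischinger R) ∧
    (Dischinger.IsLeftGoldie R → Dischinger.IsDischinger R) ∧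
    (Dischinger.IsLeftNoetherian R ∨ Dischinger.IsRightNoetherian R →
      Dischinger.IsDischinger R) := by
  refine ⟨Dischinger.isDischinger_of_nil_subrings_nilpotent,
    fun h => Dischinger.isRightDischinger_of_bounded_index fun a ha =>
      (h a ha).exists_powSucc_eq_zero,
    fun h => h.isDischinger, ?_⟩
  rintro (h | h)
  · exact h.isLeftGoldie.isDischinger
  · exact Dischinger.isDischinger_op.1 h.op.isLeftGoldie.isDischinger
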